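/- **Theorem 3.2 (Simpson).** Let $(\Phi^X_e)_{e\in\mathbb N}$ be a standard listing of the partial functions computable in $X\subseteq\mathbb N$, let $J^X(n)=\Phi^X_n(n)$, and let $X'=\{e : J^X(e)\downarrow\}$ be the Turing jump of $X$. Call $Z\subseteq\mathbb N$ *superhigh* if $\emptyset''\le_{\mathrm{tt}} Z'$, where $\le_{\mathrm{tt}}$ is truth-table reducibility. A function $f$ is *d.n.c. relative to $\emptyset'$* if for no $x$ is $J^{\emptyset'}(x)$ defined and equal to $f(x)$. Then the class $$\mathcal K=\{Z\subseteq\mathbb N : \text{some } f:\mathbb N\to\{0,1\} \text{ with } f\le_{\mathrm{tt}} Z' \text{ is d.n.c. relative to } \emptyset'\}$$ contains every superhigh set, is a (lightface) $\Sigma^0_3$ class, that is, $\mathcal K=\{Z : \exists a\,\forall b\,\exists n\; R(a,b,Z{\upharpoonright} n)\}$ for some computable relation $R$, and has measure zero for the fair-coin Lebesgue measure on $2^{\mathbb N}$. In particular, the class of superhigh sets is contained in a $\Sigma^0_3$ class of Lebesgue measure zero. -/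

import Mathlib

open MeasureTheory

namespace Superhigh

/-- Programs for oracle computation: the basic functions, one oracle query, pairing, composition,
primitive recursion and unbounded search. -/
inductive OCode : Type
  | zero : OCode
  | succ : OCode
  | left : OCode
  | right : OCode
  | oracle : OCode
  | pair : OCode → OCode → OCode
  | comp : OCode → OCode → OCode
  | prec : OCode → OCode → OCode
  | rfind : OCode → OCode

namespace OCode

/-- The partial function computed by a program with oracle `g`. The clauses are those of
`Nat.RecursiveIn {g}`. -/
def eval (g : ℕ →. ℕ) : OCode → ℕ →. ℕ
  | zero => fun _ => Part.some 0
  | succ => fun n => Part.some (n + 1)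
  | left => fun n => Part.some (Nat.unpair n).1
  | right => fun n => Part.some (Nat.unpair n).2
  | oracle => g
  | pair c d => fun n => Nat.pair <$> eval g c n <*> eval g d n
  | comp c d => fun n => eval g d n >>= eval g c
  | prec c d => fun p =>
      (Nat.unpair p).2.rec (eval g c (Nat.unpair p).1) fun y IH => do
        let i ← IH
        eval g d (Nat.pair (Nat.unpair p).1 (Nat.pair y i))
  | rfind c => fun a => Nat.rfind fun n => (fun m => decide (m = 0)) <$> eval g c (Nat.pair a n)

/-- Gödel numbering of programs: the program with a given number. -/
def ofNat : ℕ → OCode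
  | 0 => zero
  | 1 => succ
  | 2 => left
  | 3 => right
  | 4 => oracle
  | n + 5 =>
    have h1 : (Nat.unpair (n / 4)).1 < n + 5 :=
      lt_of_le_of_lt (Nat.unpair_left_le _) (by omega)
    have h2 : (Nat.unpair (n / 4)).2 < n + 5 :=
      lt_of_le_of_lt (Nat.unpair_right_le _) (by omega)
    have h3 : n / 4 < n + 5 := by omega
    match n % 4 with
    | 0 => pair (ofNat (Nat.unpair (n / 4)).1) (ofNat (Nat.unpair (n / 4)).2)
    | 1 => comp (ofNat (Nat.unpair (n / 4)).1) (ofNat (Nat.unpair (n / 4)).2)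
    | 2 => prec (ofNat (Nat.unpair (n / 4)).1) (ofNat (Nat.unpair (n / 4)).2)
    | _ => rfind (ofNat (n / 4))

/-- The Gödel number of a program. -/
def toNat : OCode → ℕ
  | zero => 0
  | succ => 1
  | left => 2
  | right => 3
  | oracle => 4
  | pair c d => 4 * Nat.pair (toNat c) (toNat d) + 5
  | comp c d => 4 * Nat.pair (toNat c) (toNat d) + 1 + 5
  | prec c d => 4 * Nat.pair (toNat c) (toNat d) + 2 + 5
  | rfind c => 4 * toNat c + 3 + 5

theorem ofNat_toNat (c : OCode) : ofNat (toNat c) = c := by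
  induction c with
  | zero | succ | left | right | oracle => simp [toNat, ofNat]
  | pair c d hc hd =>
    have e1 : 4 * Nat.pair (toNat c) (toNat d) % 4 = 0 := by omega
    have e2 : 4 * Nat.pair (toNat c) (toNat d) / 4 = Nat.pair (toNat c) (toNat d) := by omega
    simp only [toNat]; rw [ofNat]; simp only [e1, e2, Nat.unpair_pair, hc, hd]
  | comp c d hc hd =>
    have e1 : (4 * Nat.pair (toNat c) (toNat d) + 1) % 4 = 1 := by omega
    have e2 : (4 * Nat.pair (toNat c) (toNat d) + 1) / 4 = Nat.pair (toNat c) (toNat d) := by omega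
    simp only [toNat]; rw [ofNat]; simp only [e1, e2, Nat.unpair_pair, hc, hd]
  | prec c d hc hd =>
    have e1 : (4 * Nat.pair (toNat c) (toNat d) + 2) % 4 = 2 := by omega
    have e2 : (4 * Nat.pair (toNat c) (toNat d) + 2) / 4 = Nat.pair (toNat c) (toNat d) := by omega
    simp only [toNat]; rw [ofNat]; simp only [e1, e2, Nat.unpair_pair, hc, hd]
  | rfind c hc =>
    have e1 : (4 * toNat c + 3) % 4 = 3 := by omega
    have e2 : (4 * toNat c + 3) / 4 = toNat c := by omega
    simp only [toNat]; rw [ofNat]; simp only [e1, e2, hc]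

/-- The programs with oracle `g` compute exactly the partial functions recursive in `g`. -/
theorem exists_eval_eq_iff (g f : ℕ →. ℕ) : (∃ c, eval g c = f) ↔ Nat.RecursiveIn {g} f := by
  constructor
  · rintro ⟨c, rfl⟩
    induction c with
    | zero => exact .zero
    | succ => exact .succ
    | left => exact .left
    | right => exact .right
    | oracle => exact .oracle g rfl
    | pair c d hc hd => exact .pair hc hd
    | comp c d hc hd => exact .comp hc hd
    | prec c d hc hd => exact .prec hc hd
    | rfind c hc => exact .rfind hc
  · intro h
    induction h with
    | zero => exact ⟨zero, rfl⟩
    | succ => exact ⟨succ, rfl⟩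
    | left => exact ⟨left, rfl⟩
    | right => exact ⟨right, rfl⟩
    | oracle f hf => exact ⟨oracle, (Set.mem_singleton_iff.1 hf).symm⟩
    | pair _ _ ih1 ih2 =>
      obtain ⟨c, rfl⟩ := ih1; obtain ⟨d, rfl⟩ := ih2; exact ⟨pair c d, rfl⟩
    | comp _ _ ih1 ih2 =>
      obtain ⟨c, rfl⟩ := ih1; obtain ⟨d, rfl⟩ := ih2; exact ⟨comp c d, rfl⟩
    | prec _ _ ih1 ih2 =>
      obtain ⟨c, rfl⟩ := ih1; obtain ⟨d, rfl⟩ := ih2; exact ⟨prec c d, rfl⟩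
    | rfind _ ih =>
      obtain ⟨c, rfl⟩ := ih; exact ⟨rfind c, rfl⟩

end OCode

/-- Sets of natural numbers, as points of Cantor space (identified with characteristic
functions). -/
abbrev Cantor : Type := ℕ → Bool

/-- The characteristic function of a set, as an oracle. -/
def oracleOf (X : Cantor) : ℕ →. ℕ := fun n => Part.some (X n).toNat

/-- `Φ_e^X`, the `e`-th partial function computable in `X`. -/
def Phi (e : ℕ) (X : Cantor) : ℕ →. ℕ :=
  OCode.eval (oracleOf X) (OCode.ofNat e)

/-- The list `Φ_0^X, Φ_1^X, …` consists of exactly the partial functions computable in `X`. -/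
theorem exists_Phi_eq_iff (X : Cantor) (f : ℕ →. ℕ) :
    (∃ e, Phi e X = f) ↔ Nat.RecursiveIn {oracleOf X} f := by
  rw [← OCode.exists_eval_eq_iff]
  constructor
  · rintro ⟨e, h⟩
    exact ⟨OCode.ofNat e, h⟩
  · rintro ⟨c, h⟩
    exact ⟨c.toNat, by rw [Phi, OCode.ofNat_toNat, h]⟩

/-- `J^X(n) = Φ_n^X(n)`. -/
def J (X : Cantor) (n : ℕ) : Part ℕ := Phi n X n

open Classical in
/-- The Turing jump `X' = {e : J^X(e) is defined}`. -/
noncomputable def jump (X : Cantor) : Cantor := fun e => decide (J X e).Dom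

/-- The empty set. -/
def empty : Cantor := fun _ => false

/-- `A ≤_tt B`: a computable procedure assigns to every `n` a finite list of queries to `B` and
a Boolean function (a truth table) that yields `A(n)` when applied to the answers. -/
def TTReducible (A B : Cantor) : Prop :=
  ∃ (q : ℕ → List ℕ) (t : ℕ → List Bool → Bool), Computable q ∧ Computable₂ t ∧
    ∀ n, A n = t n ((q n).map B)

/-- The superhigh sets: those `Z` with `∅'' ≤_tt Z'`. -/
def Shigh : Set Cantor := {Z | TTReducible (jump (jump empty)) (jump Z)}

/-- `f` is diagonally non-computable relative to `X`: never `f(x) = J^X(x)`. -/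
def DNCRel (X : Cantor) (f : ℕ → ℕ) : Prop := ∀ x, f x ∉ J X x

/-- The class of all `Z` such that some `{0,1}`-valued function `f ≤_tt Z'` is d.n.c. relative
to `∅'`. -/
def dncClass : Set Cantor :=
  {Z | ∃ f : Cantor, TTReducible f (jump Z) ∧ DNCRel (jump empty) (fun x => (f x).toNat)}

/-- The initial segment of `Z` of length `n`. -/
def initSeg (Z : Cantor) (n : ℕ) : List Bool := (List.range n).map Z

/-- `C` is a (lightface) `Σ^0_3` class: for some computable relation `R`,
`C = {Z : ∃ a ∀ b ∃ n, R(a, b, Z ↾ n)}`. -/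
def IsSigma03 (C : Set Cantor) : Prop :=
  ∃ R : ℕ × ℕ × List Bool → Prop, ComputablePred R ∧
    C = {Z | ∃ a, ∀ b, ∃ n, R (a, b, initSeg Z n)}

/-- The fair-coin Lebesgue measure on Cantor space: the product of the uniform measures on
`{0,1}`. -/
noncomputable def coin : Measure Cantor :=
  Measure.infinitePi fun _ : ℕ => (PMF.uniformOfFintype Bool).toMeasure

end Superhigh

/-!
Let `K` be the class in question, `dncClass`. Three arguments carry the theorem.

*Superhigh sets belong to `K`.* The characteristic function of `{x : J^{∅'}(x) = 0}` is
`{0,1}`-valued and d.n.c. relative to `∅'`. This set is many-one reducible to `∅''`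
(`exists_jump_iff_zero_mem`), hence truth-table reducible to `Z'` if `Z` is superhigh.

*`K` is a `Σ^0_3` class.* A truth-table reduction is given by two programs, whose totality is a
`Π^0_2` condition. The jump `Z'` is the pointwise limit of the approximations
`jumpApprox (initSeg Z s)`, which are primitive recursive in the string `initSeg Z s`. A failure to
be d.n.c. relative to `∅'` means that, for some finite computation with a part of `∅'` as oracle,
from some stage on the approximations of `∅'` and `Z'` make this computation agree with the
reduction. The absence of such a failure is a `Π^0_2` condition on `Z`. So a pair of programs is
followed by a `∀ ∃` block with a primitive recursive matrix (`sigmaMatrix`).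

*`K` is null.* There are countably many truth-table reductions, so fix one, and fix `k`. There are
`k` inputs (`diagInputs`), computable from the number of a program with oracle `∅'`, at which
`J^{∅'}` returns `k` bits found by this program. The program looks for a stage `s` after which the
approximation to `Z'` changes on the queries made at these inputs only with probability at most
`2^{-k}` over `Z`; this is a `Π^0_1` condition on `s`, and some `s` meets it (`exists_stage`). It
also looks for a string `v` of length `k` that the negated output of the reduction, computed with
the stage `s` approximation, hits with probability at most `2^{-k}`; one of the `2^k` strings does.
It returns the bits of `v`. If the output of the reduction is d.n.c. relative to `∅'`, then its
negation agrees with `v` at the `k` inputs, and this has probability at most `2 · 2^{-k}`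
(`coin_negOutput_le`).

To make the approximations computable, programs with a finite string as oracle are translated into
the programs `Nat.Partrec.Code` of Mathlib (`OCode.toCode`), for which the primitive recursive
step-bounded evaluation `Nat.Partrec.Code.evaln` is available.
-/

namespace Superhigh

open Nat.Partrec (Code)
open Filter
open scoped ENNReal

/-! ### Programs with an oracle -/

namespace OCode

/-- The oracle-free program obtained from `c` by replacing every oracle query with a call of the
program `o`. The search operator of `Nat.Partrec.Code` starts at a given bound, here `0`. -/
def toCode (o : Code) : OCode → Code
  | zero => .zero
  | succ => .succ
  | left => .left
  | right => .right
  | oracle => o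
  | pair c d => .pair (toCode o c) (toCode o d)
  | comp c d => .comp (toCode o c) (toCode o d)
  | prec c d => .prec (toCode o c) (toCode o d)
  | rfind c => .comp (.rfind' (toCode o c)) (.pair .id .zero)

theorem eval_toCode (o : Code) (c : OCode) : (toCode o c).eval = eval o.eval c := by
  induction c with
  | zero | succ | left | right => rfl
  | oracle => rfl
  | pair c d hc hd => funext n; simp [toCode, Code.eval, eval, hc, hd]
  | comp c d hc hd => funext n; simp [toCode, Code.eval, eval, hc, hd]
  | prec c d hc hd => funext n; simp [toCode, Code.eval, eval, hc, hd]
  | rfind c hc =>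
    funext n
    have h : (Code.pair .id .zero).eval n = Part.some (Nat.pair n 0) := by
      simp [Code.eval, Seq.seq, pure, PFun.pure]
    change (Code.pair .id .zero).eval n >>= (Code.rfind' (toCode o c)).eval = _
    rw [h]
    simp [Code.eval, eval, hc, Part.map_id']

/-- Translation is primitive recursive on Gödel numbers, by course-of-values recursion: the list `l`
holds the translations of the programs with smaller numbers. -/
theorem primrec_toCode : Primrec₂ fun (o : Code) (n : ℕ) => toCode o (ofNat n) := by
  have hbody : Primrec₂ fun (o : Code) (l : List Code) =>
      (l.length.casesOn (some .zero) fun n => n.casesOn (some .succ) fun n =>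
        n.casesOn (some .left) fun n => n.casesOn (some .right) fun n =>
        n.casesOn (some o) fun n =>
          (l[n / 4]?).bind fun h => (l[(n / 4).unpair.1]?).bind fun h1 =>
          (l[(n / 4).unpair.2]?).map fun h2 =>
            if n % 4 = 0 then .pair h1 h2 else if n % 4 = 1 then .comp h1 h2
            else if n % 4 = 2 then .prec h1 h2
            else .comp (.rfind' h) (.pair .id .zero) : Option Code) := by
    refine .mk <| Primrec.nat_casesOn (Primrec.list_length.comp Primrec.snd) (.const _) <| .mk <|
      Primrec.nat_casesOn Primrec.snd (.const _) <| .mk <|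
      Primrec.nat_casesOn Primrec.snd (.const _) <| .mk <|
      Primrec.nat_casesOn Primrec.snd (.const _) <| .mk <|
      Primrec.nat_casesOn Primrec.snd (Primrec.option_some_iff.2 (Primrec.fst.comp <|
        Primrec.fst.comp <| Primrec.fst.comp <| Primrec.fst.comp Primrec.fst)) <| .mk ?_
    have hl : Primrec fun a : (((((Code × List Code) × ℕ) × ℕ) × ℕ) × ℕ) × ℕ =>
        a.1.1.1.1.1.2 := Primrec.snd.comp <| Primrec.fst.comp <| Primrec.fst.comp <|
      Primrec.fst.comp <| Primrec.fst.comp Primrec.fst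
    have hm : Primrec fun a : (((((Code × List Code) × ℕ) × ℕ) × ℕ) × ℕ) × ℕ => a.2 / 4 :=
      Primrec.nat_div.comp Primrec.snd (.const 4)
    have hr : Primrec fun a : (((((Code × List Code) × ℕ) × ℕ) × ℕ) × ℕ) × ℕ => a.2 % 4 :=
      Primrec.nat_mod.comp Primrec.snd (.const 4)
    refine Primrec.option_bind (Primrec.list_getElem?.comp hl hm) <| .mk <|
      Primrec.option_bind ((Primrec.list_getElem?.comp hl
        (Primrec.fst.comp (Primrec.unpair.comp hm))).comp Primrec.fst) <| .mk <|
      Primrec.option_map ((Primrec.list_getElem?.comp hl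
        (Primrec.snd.comp (Primrec.unpair.comp hm))).comp (Primrec.fst.comp Primrec.fst)) <| .mk ?_
    have hr' := hr.comp (Primrec.fst.comp <| Primrec.fst.comp
      (Primrec.fst (α := (((((((Code × List Code) × ℕ) × ℕ) × ℕ) × ℕ) × ℕ) × Code) × Code)
        (β := Code)))
    have h1 := Primrec.snd.comp
      (Primrec.fst (α := (((((((Code × List Code) × ℕ) × ℕ) × ℕ) × ℕ) × ℕ) × Code) × Code)
        (β := Code))
    have h := Primrec.snd.comp <| Primrec.fst.comp
      (Primrec.fst (α := (((((((Code × List Code) × ℕ) × ℕ) × ℕ) × ℕ) × ℕ) × Code) × Code)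
        (β := Code))
    exact Primrec.ite (Primrec.eq.comp hr' (.const 0)) (Code.primrec₂_pair.comp h1 Primrec.snd) <|
      Primrec.ite (Primrec.eq.comp hr' (.const 1)) (Code.primrec₂_comp.comp h1 Primrec.snd) <|
      Primrec.ite (Primrec.eq.comp hr' (.const 2)) (Code.primrec₂_prec.comp h1 Primrec.snd) <|
      Code.primrec₂_comp.comp (Code.primrec_rfind'.comp h) (.const _)
  refine Primrec.nat_strong_rec _ hbody fun o n => ?_
  match n with
  | 0 | 1 | 2 | 3 | 4 =>
    rw [List.length_map, List.length_range]
    simp only [ofNat, toCode]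
    rfl
  | n + 5 =>
    have h1 : (Nat.unpair (n / 4)).1 < n + 5 :=
      lt_of_le_of_lt (Nat.unpair_left_le _) (by omega)
    have h2 : (Nat.unpair (n / 4)).2 < n + 5 :=
      lt_of_le_of_lt (Nat.unpair_right_le _) (by omega)
    have h3 : n / 4 < n + 5 := by omega
    have h4 : n % 4 < 4 := Nat.mod_lt _ (by omega)
    simp only [List.length_map, List.length_range, List.getElem?_map, List.getElem?_range h1,
      List.getElem?_range h2, List.getElem?_range h3, Option.map_some, Option.bind_some]
    rw [ofNat]
    generalize n % 4 = r at h4 ⊢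
    interval_cases r <;> simp [toCode]

theorem mem_eval_comp {g : ℕ →. ℕ} {c d : OCode} {n m : ℕ} :
    m ∈ eval g (comp c d) n ↔ ∃ a ∈ eval g d n, m ∈ eval g c a :=
  Part.mem_bind_iff

theorem mem_eval_pair {g : ℕ →. ℕ} {c d : OCode} {n m : ℕ} :
    m ∈ eval g (pair c d) n ↔ ∃ a ∈ eval g c n, ∃ b ∈ eval g d n, Nat.pair a b = m := by
  simp [eval, Seq.seq]

theorem mem_eval_rfind {g : ℕ →. ℕ} {c : OCode} {n m : ℕ} :
    m ∈ eval g (rfind c) n ↔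
      0 ∈ eval g c (Nat.pair n m) ∧ ∀ k < m, ∃ b ∈ eval g c (Nat.pair n k), b ≠ 0 := by
  have key : ∀ k β, β ∈ ((fun x => decide (x = 0)) <$> eval g c (Nat.pair n k) : Part Bool) ↔
      ∃ a ∈ eval g c (Nat.pair n k), decide (a = 0) = β := fun k β => Part.mem_map_iff _
  refine Nat.mem_rfind.trans (and_congr ((key m true).trans (by simp)) ?_)
  exact forall₂_congr fun k _ => (key k false).trans (by simp)

/-- The use principle: a computation asks finitely many oracle questions, so its value is retained
by oracles that converge pointwise. -/
theorem eventually_mem_eval {ι : Type*} {l : Filter ι} {g : ℕ →. ℕ} {G : ι → ℕ →. ℕ}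
    (h : ∀ n m, m ∈ g n → ∀ᶠ i in l, m ∈ G i n) (c : OCode) {n m : ℕ} (hm : m ∈ eval g c n) :
    ∀ᶠ i in l, m ∈ eval (G i) c n := by
  induction c generalizing n m with
  | zero | succ | left | right => exact Eventually.of_forall fun _ => hm
  | oracle => exact h n m hm
  | pair c d hc hd =>
    obtain ⟨a, ha, b, hb, rfl⟩ := mem_eval_pair.1 hm
    filter_upwards [hc ha, hd hb] with i h1 h2 using mem_eval_pair.2 ⟨a, h1, b, h2, rfl⟩
  | comp c d hc hd =>
    obtain ⟨a, ha, hb⟩ := mem_eval_comp.1 hm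
    filter_upwards [hd ha, hc hb] with i h1 h2 using mem_eval_comp.2 ⟨a, h1, h2⟩
  | prec c d hc hd =>
    simp only [eval] at hm ⊢
    generalize (Nat.unpair n).2 = y at hm ⊢
    induction y generalizing m with
    | zero => exact hc hm
    | succ y ih =>
      obtain ⟨a, ha, hb⟩ := Part.mem_bind_iff.1 hm
      filter_upwards [ih ha, hd hb] with i h1 h2 using Part.mem_bind_iff.2 ⟨a, h1, h2⟩
  | rfind c hc =>
    obtain ⟨h0, hlt⟩ := mem_eval_rfind.1 hm
    have hlt' : ∀ k ∈ Set.Iio m, ∀ᶠ i in l, ∃ b ∈ eval (G i) c (Nat.pair n k), b ≠ 0 := by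
      intro k hk
      obtain ⟨b, hb, hb0⟩ := hlt k hk
      filter_upwards [hc hb] with i hi using ⟨b, hi, hb0⟩
    filter_upwards [hc h0, (Set.finite_Iio m).eventually_all.2 hlt'] with i h1 h2
      using mem_eval_rfind.2 ⟨h1, h2⟩

theorem eval_mono {g g' : ℕ →. ℕ} (h : ∀ n m, m ∈ g n → m ∈ g' n) (c : OCode) {n m : ℕ}
    (hm : m ∈ eval g c n) : m ∈ eval g' c n := by
  simpa using eventually_mem_eval (l := pure ()) (G := fun _ => g') (by simpa using h) c hm

/-- A program with constant value `n`. -/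
def const : ℕ → OCode
  | 0 => zero
  | n + 1 => comp succ (const n)

@[simp] theorem eval_const (g : ℕ →. ℕ) (n k : ℕ) : eval g (const n) k = Part.some n := by
  induction n with
  | zero => rfl
  | succ n ih => simp [const, eval, ih]

theorem primrec_toNat_const : Primrec fun n => (const n).toNat := by
  refine (Primrec.nat_rec₁ (f := fun _ m => 4 * Nat.pair 1 m + 1 + 5) 0 ?_).of_eq fun n => ?_
  · exact Primrec₂.comp Primrec.nat_add (Primrec₂.comp Primrec.nat_add (Primrec₂.comp Primrec.nat_mul (.const 4)
      (Primrec₂.natPair.comp (.const 1) Primrec.snd)) (.const 1)) (.const 5)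
  · induction n with
    | zero => rfl
    | succ n ih => simp only [ih, const, toNat]

theorem ofNat_comp_number (a b : ℕ) :
    ofNat (4 * Nat.pair a b + 1 + 5) = comp (ofNat a) (ofNat b) := by
  have e1 : (4 * Nat.pair a b + 1) % 4 = 1 := by omega
  have e2 : (4 * Nat.pair a b + 1) / 4 = Nat.pair a b := by omega
  rw [ofNat]
  simp only [e1, e2, Nat.unpair_pair]

/-- The Gödel number of a composition is primitive recursive in those of its parts. -/
theorem primrec₂_comp_number : Primrec₂ fun a b => 4 * Nat.pair a b + 1 + 5 :=
  Primrec₂.comp Primrec.nat_add (Primrec₂.comp Primrec.nat_add (Primrec₂.comp Primrec.nat_mul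
    (.const 4) Primrec₂.natPair) (.const 1)) (.const 5)

theorem exists_eval_eq_of_partrec {f : ℕ →. ℕ} (hf : Nat.Partrec f) :
    ∃ c : OCode, ∀ g, eval g c = f := by
  induction hf with
  | zero => exact ⟨zero, fun _ => rfl⟩
  | succ => exact ⟨succ, fun _ => rfl⟩
  | left => exact ⟨left, fun _ => rfl⟩
  | right => exact ⟨right, fun _ => rfl⟩
  | pair _ _ ih1 ih2 =>
    obtain ⟨c, hc⟩ := ih1; obtain ⟨d, hd⟩ := ih2
    exact ⟨pair c d, fun g => by simp only [eval, hc, hd]; rfl⟩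
  | comp _ _ ih1 ih2 =>
    obtain ⟨c, hc⟩ := ih1; obtain ⟨d, hd⟩ := ih2
    exact ⟨comp c d, fun g => by simp only [eval, hc, hd]; rfl⟩
  | prec _ _ ih1 ih2 =>
    obtain ⟨c, hc⟩ := ih1; obtain ⟨d, hd⟩ := ih2
    exact ⟨prec c d, fun g => by simp only [eval, hc, hd]; rfl⟩
  | rfind _ ih =>
    obtain ⟨c, hc⟩ := ih
    exact ⟨rfind c, fun g => by simp only [eval, hc]; rfl⟩

theorem exists_eval_eq_of_computable {f : ℕ → ℕ} (hf : Computable f) :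
    ∃ c : OCode, ∀ g n, eval g c n = Part.some (f n) := by
  obtain ⟨c, hc⟩ := exists_eval_eq_of_partrec (Partrec.nat_iff.1 hf.partrec)
  exact ⟨c, fun g n => by rw [hc]; rfl⟩

end OCode

/-! ### Approximating the Turing jump -/

/-- A finite string as a partial oracle: queries beyond its length are left unanswered. -/
def strOracle (σ : List Bool) : ℕ →. ℕ := fun n => ((σ[n]?).map Bool.toNat : Option ℕ)

theorem exists_code_strOracle :
    ∃ o : List Bool → Code, Primrec o ∧ ∀ σ, (o σ).eval = strOracle σ := by
  have hp : Primrec₂ fun (σ : List Bool) (n : ℕ) => (σ[n]?).map Bool.toNat :=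
    Primrec.option_map (Primrec.list_getElem?.comp Primrec.fst Primrec.snd)
      ((Primrec.dom_finite Bool.toNat).comp Primrec.snd)
  have hf : Partrec fun p : ℕ => ((Encodable.decode (α := List Bool) p.unpair.1).bind
      fun σ => (σ[p.unpair.2]?).map Bool.toNat : Part ℕ) :=
    (Primrec.option_bind (Primrec.decode.comp (Primrec.fst.comp Primrec.unpair))
      (hp.comp Primrec.snd (Primrec.snd.comp (Primrec.unpair.comp Primrec.fst))).to₂).to_comp.ofOption
  obtain ⟨c, hc⟩ := Code.exists_code.1 (Partrec.nat_iff.1 hf)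
  refine ⟨fun σ => c.curry (Encodable.encode σ), Code.primrec₂_curry.comp (.const c) .encode,
    fun σ => funext fun n => ?_⟩
  rw [Code.eval_curry, hc]
  simp [strOracle]

/-- A code for the partial oracle given by a string. -/
noncomputable def strCode : List Bool → Code := exists_code_strOracle.choose

theorem primrec_strCode : Primrec strCode := exists_code_strOracle.choose_spec.1

theorem eval_strCode (σ : List Bool) : (strCode σ).eval = strOracle σ :=
  exists_code_strOracle.choose_spec.2 σ

/-- `Φ_e^σ(x)` after `k` steps, for a finite string `σ` as oracle. -/
noncomputable def phiStep (k : ℕ) (σ : List Bool) (e x : ℕ) : Option ℕ :=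
  (OCode.toCode (strCode σ) (OCode.ofNat e)).evaln k x

theorem primrec_phiStep :
    Primrec fun a : ℕ × List Bool × ℕ × ℕ => phiStep a.1 a.2.1 a.2.2.1 a.2.2.2 := by
  have h : Primrec fun a : ℕ × List Bool × ℕ × ℕ =>
      OCode.toCode (strCode a.2.1) (OCode.ofNat a.2.2.1) :=
    OCode.primrec_toCode.comp (primrec_strCode.comp (Primrec.fst.comp Primrec.snd))
      (Primrec.fst.comp (Primrec.snd.comp Primrec.snd))
  exact Code.primrec_evaln.comp ((Primrec.fst.pair h).pair
    (Primrec.snd.comp (Primrec.snd.comp Primrec.snd)))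

@[simp] theorem length_initSeg (Z : Cantor) (n : ℕ) : (initSeg Z n).length = n := by
  simp [initSeg]

theorem getElem?_initSeg (Z : Cantor) {n i : ℕ} (h : i < n) : (initSeg Z n)[i]? = some (Z i) := by
  simp [initSeg, h]

theorem take_initSeg (Z : Cantor) (n m : ℕ) : (initSeg Z n).take m = initSeg Z (min m n) := by
  rw [initSeg, ← List.map_take, List.take_range, initSeg]

theorem mem_Phi_of_phiStep {Z : Cantor} {k u e x m : ℕ} (h : phiStep k (initSeg Z u) e x = some m) :
    m ∈ Phi e Z x := by
  have := Code.evaln_sound (Option.mem_def.2 h)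
  rw [OCode.eval_toCode, eval_strCode] at this
  refine OCode.eval_mono (fun n m hm => ?_) _ this
  simp only [strOracle, Part.mem_ofOption, Option.mem_def, Option.map_eq_some_iff] at hm
  obtain ⟨b, hb, rfl⟩ := hm
  have hn : n < u := by
    by_contra hn
    rw [List.getElem?_eq_none (by simpa using hn)] at hb
    simp at hb
  rw [getElem?_initSeg _ hn] at hb
  simp [oracleOf, Option.some.inj hb]

theorem eventually_phiStep {Z : Cantor} {e x m : ℕ} (h : m ∈ Phi e Z x) :
    ∀ᶠ u in atTop, ∃ k, phiStep k (initSeg Z u) e x = some m := by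
  have := OCode.eventually_mem_eval (l := atTop) (G := fun u => strOracle (initSeg Z u))
    (fun n m hm => by
      filter_upwards [eventually_gt_atTop n] with u hu
      rw [oracleOf, Part.mem_some_iff] at hm
      simp [strOracle, getElem?_initSeg _ hu, hm]) _ h
  filter_upwards [this] with u hu
  rw [← eval_strCode, ← OCode.eval_toCode, Code.evaln_complete] at hu
  exact hu

/-- The stage `|σ|` approximation to the jump of the sets extending `σ`: whether `J(e)` is defined
after `|σ|` steps, with some initial segment of `σ` as oracle. Shorter initial segments are
admitted to make the approximation monotone in `σ`. -/
noncomputable def jumpApprox (σ : List Bool) (e : ℕ) : Bool :=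
  decide (∃ u < σ.length + 1, (phiStep σ.length (σ.take u) e e).isSome = true)

theorem primrec_jumpApprox : Primrec₂ jumpApprox := by
  have hσ : Primrec fun a : ℕ × List Bool × ℕ => a.2.1 := Primrec.fst.comp Primrec.snd
  have he : Primrec fun a : ℕ × List Bool × ℕ => a.2.2 := Primrec.snd.comp Primrec.snd
  have h : Primrec fun a : ℕ × List Bool × ℕ =>
      (phiStep a.2.1.length (a.2.1.take a.1) a.2.2 a.2.2).isSome :=
    Primrec.option_isSome.comp (primrec_phiStep.comp ((Primrec.list_length.comp hσ).pair
      ((Primrec.list_take.comp Primrec.fst hσ).pair (he.pair he))))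
  have h' : PrimrecRel fun (u : ℕ) (a : List Bool × ℕ) =>
      (phiStep a.1.length (a.1.take u) a.2 a.2).isSome = true :=
    Primrec.eq.comp h (.const true)
  have h'' : PrimrecPred fun a : List Bool × ℕ =>
      ∃ u < a.1.length + 1, (phiStep a.1.length (a.1.take u) a.2 a.2).isSome = true :=
    (PrimrecRel.comp h'.exists_mem_list (Primrec.list_range.comp (Primrec.succ.comp
      (Primrec.list_length.comp Primrec.fst))) Primrec.id).of_eq (by simp)
  exact h''.decide

theorem jumpApprox_initSeg {Z : Cantor} {s e : ℕ} :
    jumpApprox (initSeg Z s) e = true ↔ ∃ u ≤ s, (phiStep s (initSeg Z u) e e).isSome := by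
  simp only [jumpApprox, length_initSeg, decide_eq_true_eq, Nat.lt_succ_iff, take_initSeg]
  refine exists_congr fun u => and_congr_right fun hu => ?_
  rw [min_eq_left hu]

theorem jumpApprox_mono {Z : Cantor} {s t e : ℕ} (hst : s ≤ t)
    (h : jumpApprox (initSeg Z s) e = true) : jumpApprox (initSeg Z t) e = true := by
  rw [jumpApprox_initSeg] at h ⊢
  obtain ⟨u, hu, h⟩ := h
  obtain ⟨m, hm⟩ := Option.isSome_iff_exists.1 h
  exact ⟨u, hu.trans hst, Option.isSome_iff_exists.2
    ⟨m, Code.evaln_mono hst (Option.mem_def.2 hm)⟩⟩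

theorem jump_eq_true {Z : Cantor} {e : ℕ} : jump Z e = true ↔ ∃ m, m ∈ Phi e Z e := by
  rw [← Part.dom_iff_mem]
  exact @decide_eq_true_iff _ (Classical.propDecidable _)

theorem jump_eq_true_iff {Z : Cantor} {e : ℕ} :
    jump Z e = true ↔ ∃ s, jumpApprox (initSeg Z s) e = true := by
  rw [jump_eq_true]
  constructor
  · rintro ⟨m, hm⟩
    obtain ⟨u, k, h⟩ := (eventually_phiStep hm).exists
    refine ⟨max u k, jumpApprox_initSeg.2 ⟨u, le_max_left _ _, Option.isSome_iff_exists.2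
      ⟨m, Code.evaln_mono (le_max_right _ _) (Option.mem_def.2 h)⟩⟩⟩
  · rintro ⟨s, h⟩
    obtain ⟨u, -, h⟩ := jumpApprox_initSeg.1 h
    obtain ⟨m, hm⟩ := Option.isSome_iff_exists.1 h
    exact ⟨m, mem_Phi_of_phiStep hm⟩

theorem eventually_jumpApprox_eq (Z : Cantor) (e : ℕ) :
    ∀ᶠ s in atTop, jumpApprox (initSeg Z s) e = jump Z e := by
  by_cases h : jump Z e = true
  · obtain ⟨s, hs⟩ := jump_eq_true_iff.1 h
    filter_upwards [eventually_ge_atTop s] with t ht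
    rw [h, jumpApprox_mono ht hs]
  · refine Eventually.of_forall fun s => ?_
    rw [Bool.eq_false_iff.2 h, Bool.eq_false_iff]
    exact fun hs => h (jump_eq_true_iff.2 ⟨s, hs⟩)

theorem eventually_map_jumpApprox_eq (Z : Cantor) (l : List ℕ) :
    ∀ᶠ s in atTop, l.map (jumpApprox (initSeg Z s)) = l.map (jump Z) := by
  induction l with
  | nil => simp
  | cons a l ih =>
    filter_upwards [ih, eventually_jumpApprox_eq Z a] with s h1 h2
    simp [h1, h2]

/-! ### Superhigh sets compute d.n.c. functions from their jump -/

/-- Every c.e. set is many-one reducible to every jump, by a reduction that does not depend on the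
oracle. -/
theorem exists_jump_iff_dom {α : Type*} [Primcodable α] {ψ : α →. ℕ} (hψ : Partrec ψ) :
    ∃ h : α → ℕ, Computable h ∧ ∀ X y, jump X (h y) = true ↔ (ψ y).Dom := by
  have h1 : Nat.Partrec fun n => Part.bind (Encodable.decode (α := α) n) ψ :=
    Partrec.nat_iff.1 ((Computable.decode.ofOption).bind (hψ.comp Computable.snd).to₂)
  obtain ⟨c, hc⟩ := OCode.exists_eval_eq_of_partrec h1
  refine ⟨fun y => OCode.toNat (.comp c (.const (Encodable.encode y))), ?_, fun X y => ?_⟩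
  · have h2 := OCode.primrec_toNat_const.comp (Primrec.encode (α := α))
    exact (OCode.primrec₂_comp_number.comp (.const c.toNat) h2).to_comp
  · rw [jump_eq_true, Part.dom_iff_mem]
    simp only [Phi, OCode.ofNat_toNat, OCode.mem_eval_comp, OCode.eval_const, Part.mem_some_iff,
      exists_eq_left, hc, Encodable.encodek, Part.coe_some]
    exact exists_congr fun m => Part.mem_bind_iff.trans (by simp)

/-- The set `{x : J^X(x) = 0}` is many-one reducible to `X'`, uniformly in `X`. -/
theorem exists_jump_iff_zero_mem :
    ∃ h : ℕ → ℕ, Computable h ∧ ∀ X x, jump X (h x) = true ↔ 0 ∈ J X x := by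
  refine ⟨fun x => 4 * Nat.pair (OCode.toNat (.rfind .left))
      (4 * Nat.pair x (OCode.const x).toNat + 1 + 5) + 1 + 5, ?_, fun X x => ?_⟩
  · exact (OCode.primrec₂_comp_number.comp (.const _) (OCode.primrec₂_comp_number.comp .id
      OCode.primrec_toNat_const)).to_comp
  -- The program `rfind left` halts on `m` if and only if `m = 0`.
  · have hz : ∀ m, (∃ k, k ∈ OCode.eval (oracleOf X) (.rfind .left) m) ↔ m = 0 := fun m => by
      have hl : ∀ k b, b ∈ OCode.eval (oracleOf X) .left (Nat.pair m k) ↔ b = m := fun k b => by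
        simp [OCode.eval]
      simp only [OCode.mem_eval_rfind, hl]
      constructor
      · rintro ⟨_, h, -⟩
        exact h.symm
      · rintro rfl
        exact ⟨0, rfl, by simp⟩
    rw [jump_eq_true]
    simp only [J, Phi, OCode.ofNat_comp_number, OCode.ofNat_toNat, OCode.mem_eval_comp,
      OCode.eval_const, Part.mem_some_iff, exists_eq_left]
    constructor
    · rintro ⟨y, m, hm, hy⟩
      rwa [← (hz m).1 ⟨y, hy⟩]
    · intro h
      obtain ⟨y, hy⟩ := (hz 0).2 rfl
      exact ⟨y, 0, h, hy⟩

/-- If `x ↦ r x` reduces `{x : J^{∅'}(x) = 0}` to `∅''`, then `x ↦ ∅''(r x)` is d.n.c. relative to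
`∅'`: it is `1` where `J^{∅'}` is `0`, and `0` elsewhere. -/
theorem Shigh_subset_dncClass : Shigh ⊆ dncClass := by
  rintro Z ⟨q, t, hq, ht, h⟩
  obtain ⟨r, hr, hr'⟩ := exists_jump_iff_zero_mem
  refine ⟨fun x => jump (jump empty) (r x), ⟨fun x => q (r x), fun x => t (r x), hq.comp hr,
    ht.comp (hr.comp Computable.fst) Computable.snd, fun x => h (r x)⟩, fun x hx => ?_⟩
  cases hb : jump (jump empty) (r x) with
  | true =>
    simp only [hb] at hx
    exact absurd (Part.mem_unique hx ((hr' _ _).1 hb)) (by simp)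
  | false =>
    simp only [hb] at hx
    exact absurd ((hr' (jump empty) x).2 hx) (by simp [hb])

/-! ### The arithmetical definition -/

/-- The quantifiers in the definition of a `Σ^0_3` class may range over any coded types. -/
theorem isSigma03_of_primrec {α β : Type*} [Primcodable α] [Primcodable β]
    {R : α × β × List Bool → Bool} (hR : Primrec R) :
    IsSigma03 {Z | ∃ a, ∀ b, ∃ n, R (a, b, initSeg Z n) = true} := by
  let R' : ℕ × ℕ × List Bool → Bool := fun p =>
    ((Encodable.decode (α := α) p.1).map fun a =>
      ((Encodable.decode (α := β) p.2.1).map fun b => R (a, b, p.2.2)).getD true).getD false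
  have hR' : Primrec R' := by
    have hin : Primrec₂ fun (p : ℕ × ℕ × List Bool) (a : α) =>
        ((Encodable.decode (α := β) p.2.1).map fun b => R (a, b, p.2.2)).getD true := by
      refine Primrec.option_getD.comp (Primrec.option_map (Primrec.decode.comp
        (Primrec.fst.comp (Primrec.snd.comp Primrec.fst))) (.mk ?_)) (.const true)
      exact hR.comp ((Primrec.snd.comp Primrec.fst).pair (Primrec.snd.pair (Primrec.snd.comp
        (Primrec.snd.comp (Primrec.fst.comp Primrec.fst)))))
    exact Primrec.option_getD.comp (Primrec.option_map (Primrec.decode.comp Primrec.fst) hin)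
      (.const false)
  refine ⟨fun p => R' p = true, (Primrec.eq.comp hR' (.const true)).computablePred, ?_⟩
  ext Z
  constructor
  · rintro ⟨a, ha⟩
    refine ⟨Encodable.encode a, fun b => ?_⟩
    cases hb : Encodable.decode (α := β) b with
    | none => exact ⟨0, by simp [R', hb]⟩
    | some b => simpa [R', hb] using ha b
  · rintro ⟨a, ha⟩
    cases h : Encodable.decode (α := α) a with
    | none =>
      obtain ⟨n, hn⟩ := ha 0
      simp [R', h] at hn
    | some a' =>
      refine ⟨a', fun b => ?_⟩
      simpa [R', h] using ha (Encodable.encode b)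

/-- The value of the program `c` on the coded argument `a`, if it is found in `s` steps. -/
def runStep {α β : Type*} [Primcodable α] [Primcodable β] (s : ℕ) (c : Code) (a : α) : Option β :=
  (c.evaln s (Encodable.encode a)).bind Encodable.decode

section runStep
variable {α β : Type*} [Primcodable α] [Primcodable β]

theorem primrec_runStep {γ : Type*} [Primcodable γ] {s : γ → ℕ} {c : γ → Code} {f : γ → α}
    (hs : Primrec s) (hc : Primrec c) (hf : Primrec f) :
    Primrec fun x => (runStep (s x) (c x) (f x) : Option β) :=
  Primrec.option_bind (Code.primrec_evaln.comp ((hs.pair hc).pair (Primrec.encode.comp hf)))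
    (Primrec.decode.comp Primrec.snd).to₂

theorem runStep_mono {s t : ℕ} (h : s ≤ t) {c : Code} {a : α} {b : β}
    (hb : runStep s c a = some b) : runStep t c a = some b := by
  obtain ⟨m, hm, hb⟩ := Option.bind_eq_some_iff.1 hb
  exact Option.bind_eq_some_iff.2 ⟨m, Code.evaln_mono h hm, hb⟩

theorem runStep_unique {s t : ℕ} {c : Code} {a : α} {b b' : β}
    (hb : runStep s c a = some b) (hb' : runStep t c a = some b') : b = b' := by
  have h1 := runStep_mono (le_max_left s t) hb
  rw [runStep_mono (le_max_right s t) hb'] at h1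
  exact (Option.some.inj h1).symm

theorem computable_iff_exists_runStep {f : α → β} :
    Computable f ↔ ∃ c : Code, ∀ a, ∃ s, runStep s c a = some (f a) := by
  constructor
  · intro hf
    obtain ⟨c, hc⟩ := Code.exists_code.1 hf
    refine ⟨c, fun a => ?_⟩
    have : Encodable.encode (f a) ∈ c.eval (Encodable.encode a) := by simp [hc]
    obtain ⟨s, hs⟩ := Code.evaln_complete.1 this
    exact ⟨s, Option.bind_eq_some_iff.2 ⟨_, hs, Encodable.encodek _⟩⟩
  · rintro ⟨c, hc⟩
    have hp : Partrec fun a : α => Nat.rfindOpt fun s => (runStep s c a : Option β) :=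
      Partrec.rfindOpt (primrec_runStep Primrec.snd (.const c) Primrec.fst).to_comp.to₂
    refine hp.of_eq_tot fun a => (Nat.rfindOpt_mono fun {x m n} hmn hx => ?_).2 (hc a)
    exact runStep_mono hmn hx

end runStep

/-- The arguments of the matrix of the `Σ^0_3` definition of `dncClass`: two programs, which stand
for a truth-table reduction; the tuple `(x, l, u, k, s₀)`; and an initial segment of `Z`. -/
abbrev MatrixArg : Type := (Code × Code) × (ℕ × List Bool × ℕ × ℕ × ℕ) × List Bool

/-- The stage is at least `s₀`, and the bit `β` differs from the value of `Φ_x^{∅'}(x)` found in `k`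
steps with the stage `s` approximation of the first `u` bits of `∅'` as oracle, if there is one.
Here `s` is the length of the initial segment of `Z`. -/
noncomputable def differsFrom (a : MatrixArg) (β : Bool) : Bool :=
  decide (a.2.1.2.2.2.2 ≤ a.2.2.length ∧ ¬ phiStep a.2.1.2.2.2.1
    ((List.range a.2.1.2.2.1).map (jumpApprox (initSeg empty a.2.2.length))) a.2.1.1 a.2.1.1 =
      some β.toNat)

/-- The computable matrix of the `Σ^0_3` definition of `dncClass`. The two programs are meant to
compute a truth-table reduction. At stage `s`, it is verified that they have halted on the input
`x` and on the row `l` of the table for `x`; and that, with the stage `s` approximations of `Z'`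
and `∅'`, the value of the reduction at `x` differs from `Φ_x^{∅'}(x)`. -/
noncomputable def sigmaMatrix (a : MatrixArg) : Bool :=
  ((runStep a.2.2.length a.1.1 a.2.1.1 : Option (List ℕ)).bind fun Q =>
    (runStep a.2.2.length a.1.2 (a.2.1.1, a.2.1.2.1) : Option Bool).bind fun _ =>
    (runStep a.2.2.length a.1.2 (a.2.1.1, Q.map (jumpApprox a.2.2)) : Option Bool).map
      (differsFrom a)).getD false

theorem sigmaMatrix_eq_true {p : Code × Code} {x u k s₀ : ℕ} {l σ : List Bool} :
    sigmaMatrix (p, (x, l, u, k, s₀), σ) = true ↔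
      ∃ Q : List ℕ, runStep σ.length p.1 x = some Q ∧
      (∃ β : Bool, runStep σ.length p.2 (x, l) = some β) ∧
      ∃ β : Bool, runStep σ.length p.2 (x, Q.map (jumpApprox σ)) = some β ∧ s₀ ≤ σ.length ∧
        phiStep k ((List.range u).map (jumpApprox (initSeg empty σ.length))) x x ≠
          some β.toNat := by
  simp only [sigmaMatrix]
  cases h1 : (runStep σ.length p.1 x : Option (List ℕ)) with
  | none => simp
  | some Q =>
    cases h2 : (runStep σ.length p.2 (x, l) : Option Bool) with
    | none => simp
    | some β' =>
      cases h3 : (runStep σ.length p.2 (x, Q.map (jumpApprox σ)) : Option Bool) with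
      | none => simp [h3]
      | some β => cases β <;> simp [h3, differsFrom]

theorem primrec_initSeg_empty : Primrec (initSeg empty) :=
  Primrec.list_map Primrec.list_range (Primrec.const false).to₂

theorem primrec_stage : Primrec fun a : MatrixArg => a.2.2.length :=
  Primrec.list_length.comp (Primrec.snd.comp Primrec.snd)

theorem primrec_input : Primrec fun a : MatrixArg => a.2.1.1 :=
  Primrec.fst.comp (Primrec.fst.comp Primrec.snd)

theorem primrec₂_differsFrom : Primrec₂ differsFrom := by
  have hb : Primrec fun a : MatrixArg => a.2.1.2.2 :=
    Primrec.snd.comp (Primrec.snd.comp (Primrec.fst.comp Primrec.snd))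
  have hu : Primrec fun a : MatrixArg => a.2.1.2.2.1 := Primrec.fst.comp hb
  have hk : Primrec fun a : MatrixArg => a.2.1.2.2.2.1 := Primrec.fst.comp (Primrec.snd.comp hb)
  have hs0 : Primrec fun a : MatrixArg => a.2.1.2.2.2.2 := Primrec.snd.comp (Primrec.snd.comp hb)
  have hphi : Primrec fun a : MatrixArg => phiStep a.2.1.2.2.2.1
      ((List.range a.2.1.2.2.1).map (jumpApprox (initSeg empty a.2.2.length))) a.2.1.1 a.2.1.1 := by
    refine primrec_phiStep.comp (hk.pair (Primrec.pair ?_ (primrec_input.pair primrec_input)))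
    exact Primrec.list_map (Primrec.list_range.comp hu) (primrec_jumpApprox.comp
      (primrec_initSeg_empty.comp (primrec_stage.comp Primrec.fst)) Primrec.snd).to₂
  exact ((Primrec.nat_le.comp (hs0.comp Primrec.fst) (primrec_stage.comp Primrec.fst)).and
      (Primrec.eq.comp (hphi.comp Primrec.fst) (Primrec.option_some_iff.2
        ((Primrec.dom_finite Bool.toNat).comp Primrec.snd))).not).decide

theorem primrec_sigmaMatrix : Primrec sigmaMatrix := by
  have hd : Primrec fun a : MatrixArg => a.1.2 := Primrec.snd.comp Primrec.fst
  have hQ : Primrec₂ fun (a : MatrixArg) (Q : List ℕ) => Q.map (jumpApprox a.2.2) :=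
    Primrec.list_map Primrec.snd (primrec_jumpApprox.comp
      (Primrec.snd.comp (Primrec.snd.comp (Primrec.fst.comp Primrec.fst))) Primrec.snd).to₂
  have hx2 : Primrec fun a : MatrixArg × List ℕ =>
      (runStep a.1.2.2.length a.1.1.2 (a.1.2.1.1, a.2.map (jumpApprox a.1.2.2)) : Option Bool) :=
    primrec_runStep (primrec_stage.comp Primrec.fst) (hd.comp Primrec.fst)
      ((primrec_input.comp Primrec.fst).pair hQ)
  have hdf : Primrec₂ fun (a : (MatrixArg × List ℕ) × Bool) (β : Bool) => differsFrom a.1.1 β :=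
    primrec₂_differsFrom.comp (Primrec.fst.comp (Primrec.fst.comp Primrec.fst)) Primrec.snd
  have h3 : Primrec₂ fun (a : MatrixArg × List ℕ) (_ : Bool) =>
      (runStep a.1.2.2.length a.1.1.2 (a.1.2.1.1, a.2.map (jumpApprox a.1.2.2)) :
        Option Bool).map (differsFrom a.1) :=
    Primrec.option_map (hx2.comp Primrec.fst) hdf
  have hxl : Primrec fun a : MatrixArg =>
      (runStep a.2.2.length a.1.2 (a.2.1.1, a.2.1.2.1) : Option Bool) :=
    primrec_runStep primrec_stage hd (primrec_input.pair
      (Primrec.fst.comp (Primrec.snd.comp (Primrec.fst.comp Primrec.snd))))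
  have h2 : Primrec₂ fun (a : MatrixArg) (Q : List ℕ) =>
      (runStep a.2.2.length a.1.2 (a.2.1.1, a.2.1.2.1) : Option Bool).bind fun _ =>
      (runStep a.2.2.length a.1.2 (a.2.1.1, Q.map (jumpApprox a.2.2)) :
        Option Bool).map (differsFrom a) :=
    Primrec.option_bind (hxl.comp Primrec.fst) h3
  have h1 : Primrec fun a : MatrixArg =>
      (runStep a.2.2.length a.1.1 a.2.1.1 : Option (List ℕ)) :=
    primrec_runStep primrec_stage (Primrec.fst.comp Primrec.fst) primrec_input
  exact Primrec.option_getD.comp (Primrec.option_bind h1 h2) (.const false)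

/-- That the reduction `f` is d.n.c. relative to `∅'` is expressed by: for all `x`, `u`, `k` and
`s₀` there is a stage `s ≥ s₀` at which `f(x)` differs from the approximation to `Φ_x^{∅'}(x)` that
`u` and `k` determine. Both sides converge as `s` grows, so this is equivalent to their limits being
different. -/
theorem isSigma03_dncClass : IsSigma03 dncClass := by
  convert! isSigma03_of_primrec primrec_sigmaMatrix using 1
  ext Z
  constructor
  · rintro ⟨f, ⟨q, t, hq, ht, hf⟩, hdnc⟩
    obtain ⟨c, hc⟩ := computable_iff_exists_runStep.1 hq
    obtain ⟨d, hd⟩ := computable_iff_exists_runStep.1 ht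
    refine ⟨(c, d), fun ⟨x, l, u, k, s₀⟩ => ?_⟩
    obtain ⟨s₁, h₁⟩ := hc x
    obtain ⟨s₂, h₂⟩ := hd (x, l)
    obtain ⟨s₃, h₃⟩ := hd (x, (q x).map (jump Z))
    obtain ⟨s, hs₀, hs₁, hs₂, hs₃, hZ, h0⟩ := ((eventually_ge_atTop s₀).and <|
      (eventually_ge_atTop s₁).and <| (eventually_ge_atTop s₂).and <|
      (eventually_ge_atTop s₃).and <| (eventually_map_jumpApprox_eq Z (q x)).and
      (eventually_map_jumpApprox_eq empty (List.range u))).exists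
    refine ⟨s, sigmaMatrix_eq_true.2 ⟨q x, ?_⟩⟩
    rw [length_initSeg, hZ, h0]
    refine ⟨runStep_mono hs₁ h₁, ⟨_, runStep_mono hs₂ h₂⟩, _, runStep_mono hs₃ h₃, hs₀, fun h => ?_⟩
    refine hdnc x ?_
    simp only [hf x]
    exact mem_Phi_of_phiStep h
  · rintro ⟨⟨c, d⟩, h⟩
    simp only [Prod.forall, sigmaMatrix_eq_true, length_initSeg] at h
    have hc : ∀ x, ∃ Q : List ℕ, ∃ s, runStep s c x = some Q := fun x => by
      obtain ⟨s, Q, hQ, -⟩ := h x [] 0 0 0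
      exact ⟨Q, s, hQ⟩
    have hd : ∀ x l, ∃ β : Bool, ∃ s, runStep s d (x, l) = some β := fun x l => by
      obtain ⟨s, Q, -, ⟨β, hβ⟩, -⟩ := h x l 0 0 0
      exact ⟨β, s, hβ⟩
    choose q hq using hc
    choose t ht using hd
    refine ⟨fun x => t x ((q x).map (jump Z)), ⟨q, t, computable_iff_exists_runStep.2 ⟨c, hq⟩,
      computable_iff_exists_runStep.2 ⟨d, fun a => ht a.1 a.2⟩, fun _ => rfl⟩, fun x hx => ?_⟩
    obtain ⟨u, k, hk⟩ := (eventually_phiStep hx).exists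
    obtain ⟨s₀, hs₀⟩ := eventually_atTop.1 ((eventually_map_jumpApprox_eq Z (q x)).and
      (eventually_map_jumpApprox_eq empty (List.range u)))
    obtain ⟨s, Q, hQ, -, β, hβ, hs, hne⟩ := h x [] u k s₀
    obtain ⟨s₁, h₁⟩ := hq x
    obtain rfl := runStep_unique hQ h₁
    obtain ⟨hZ, h0⟩ := hs₀ s hs
    obtain ⟨s₂, h₂⟩ := ht x ((q x).map (jump Z))
    rw [hZ] at hβ
    rw [h0, runStep_unique hβ h₂] at hne
    exact hne hk

/-! ### Computable operations on lists -/

section computability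
variable {α β γ : Type*} [Primcodable α] [Primcodable β] [Primcodable γ]

theorem computable_list_map {f : α → List β} {g : α → β → γ} (hf : Computable f)
    (hg : Computable₂ g) : Computable fun a => (f a).map (g a) := by
  have hstep : Computable₂ fun (a : α) (p : ℕ × List γ) =>
      ((f a)[p.1]?.casesOn p.2 fun b => p.2 ++ [g a b] : List γ) := by
    refine Computable.option_casesOn (Computable.list_getElem?.comp (hf.comp Computable.fst)
      (Computable.fst.comp Computable.snd)) (Computable.snd.comp Computable.snd) ?_
    exact Computable.list_concat.comp (Computable.snd.comp (Computable.snd.comp Computable.fst))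
      (hg.comp (Computable.fst.comp Computable.fst) Computable.snd)
  refine (Computable.nat_rec (Computable.list_length.comp hf) (Computable.const []) hstep).of_eq
    fun a => ?_
  have : ∀ n ≤ (f a).length, (Nat.rec [] (fun n acc =>
      ((f a)[n]?.casesOn acc fun b => acc ++ [g a b] : List γ)) n : List γ) =
        ((f a).take n).map (g a) := by
    intro n hn
    induction n with
    | zero => simp
    | succ n ih =>
      have h := List.getElem?_eq_getElem (show n < (f a).length from hn)
      simp only [ih (by omega), h, List.take_add_one, Option.toList_some, List.map_append,
        List.map_cons, List.map_nil]
  simpa using this _ le_rfl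

theorem computable_list_countP {f : α → List β} {p : α → β → Bool} (hf : Computable f)
    (hp : Computable₂ p) : Computable fun a => (f a).countP (p a) := by
  have h : Primrec fun l : List Bool => l.countP id := by
    refine (Primrec.list_foldr (h := fun _ (b : Bool × ℕ) => bif b.1 then b.2 + 1 else b.2)
      Primrec.id (.const 0) ?_).of_eq fun l => ?_
    · have hs : Primrec fun x : List Bool × Bool × ℕ => x.2.2 := Primrec.snd.comp Primrec.snd
      exact Primrec.cond (Primrec.fst.comp Primrec.snd) (Primrec.succ.comp hs) hs
    · induction l with
      | nil => rfl
      | cons b l ih => cases b <;> simp_all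
  refine (h.to_comp.comp (computable_list_map hf hp)).of_eq fun a => ?_
  rw [List.countP_map]
  rfl

end computability

/-! ### Binary strings of a given length -/

/-- The list of all strings of length `n`. -/
def strings : ℕ → List (List Bool)
  | 0 => [[]]
  | n + 1 => (strings n).flatMap fun σ => [σ ++ [false], σ ++ [true]]

theorem primrec_strings : Primrec strings := by
  have h : Primrec₂ fun (_ : ℕ) (L : List (List Bool)) =>
      L.flatMap fun σ => [σ ++ [false], σ ++ [true]] := by
    refine Primrec.list_flatMap Primrec.snd ?_
    exact Primrec.list_cons.comp (Primrec.list_concat.comp Primrec.snd (.const false))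
      (Primrec.list_cons.comp (Primrec.list_concat.comp Primrec.snd (.const true)) (.const []))
  refine (Primrec.nat_rec₁ [[]] h).of_eq fun n => ?_
  induction n with
  | zero => rfl
  | succ n ih => simp only [ih, strings]

theorem mem_strings {n : ℕ} {σ : List Bool} : σ ∈ strings n ↔ σ.length = n := by
  induction n generalizing σ with
  | zero => simp [strings]
  | succ n ih =>
    simp only [strings, List.mem_flatMap, ih, List.mem_cons, List.not_mem_nil, or_false]
    constructor
    · rintro ⟨τ, rfl, rfl | rfl⟩ <;> simp
    · intro h
      have hne : σ ≠ [] := by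
        rintro rfl
        simp at h
      refine ⟨σ.dropLast, by simp [h], ?_⟩
      rw [← List.dropLast_append_getLast hne]
      cases σ.getLast hne <;> simp

theorem length_strings (n : ℕ) : (strings n).length = 2 ^ n := by
  induction n with
  | zero => rfl
  | succ n ih => simp [strings, List.length_flatMap, ih, pow_succ]

theorem nodup_strings (n : ℕ) : (strings n).Nodup := by
  induction n with
  | zero => simp [strings]
  | succ n ih =>
    refine List.nodup_flatMap.2 ⟨fun σ _ => by simp, ih.imp fun {σ τ} hne => ?_⟩
    simpa [List.disjoint_left, Function.onFun] using hne

theorem countP_strings (p : List Bool → Bool) (n : ℕ) :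
    (strings n).countP p = ((strings n).toFinset.filter fun σ => p σ = true).card := by
  rw [← List.toFinset_filter, List.toFinset_card_of_nodup ((nodup_strings n).filter _),
    List.countP_eq_length_filter]

/-! ### Searching with the halting problem as oracle -/

theorem rfind_some_dom {p : ℕ → Bool} :
    (Nat.rfind fun t => Part.some (p t)).Dom ↔ ∃ t, p t = true :=
  ⟨fun h => ⟨_, (Part.mem_some_iff.1 (Nat.rfind_spec (Part.get_mem h))).symm⟩,
    fun ⟨t, ht⟩ => Nat.rfind_dom.2 ⟨t, Part.mem_some_iff.2 ht.symm, fun _ => trivial⟩⟩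

/-- With `∅'` as oracle one can search for a `w` that stands in a `Π^0_1` relation to `y`, and
output a computable function of it. The value may depend on a further argument `j`, which does not
influence the choice of `w`. -/
theorem exists_code_search {α : Type*} [Primcodable α] {D : ℕ × α × ℕ → Bool} (hD : Computable D)
    {G : ℕ × α → ℕ} (hG : Computable G) :
    ∃ c : OCode, ∀ y, (∃ w, ∀ t, D (y, w, t) = true) → ∃ w, (∀ t, D (y, w, t) = true) ∧
      ∀ j, G (j, w) ∈ c.eval (oracleOf (jump empty)) (Nat.pair j y) := by
  let D' : ℕ × ℕ → ℕ → Bool := fun a t =>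
    (Encodable.decode (α := α) a.2).casesOn true fun w => !D (a.1, w, t)
  have hD' : Computable₂ D' := by
    refine Computable.option_casesOn (Computable.decode.comp
      (Computable.snd.comp Computable.fst)) (.const true) ?_
    exact Primrec.not.to_comp.comp (hD.comp ((Computable.fst.comp
      (Computable.fst.comp Computable.fst)).pair (Computable.snd.pair
      (Computable.snd.comp Computable.fst))))
  have hψ : Partrec fun a : ℕ × ℕ => Nat.rfind fun t => (Part.some (D' a t)) :=
    Partrec.rfind hD'.partrec₂
  obtain ⟨h, hh, hdom⟩ := exists_jump_iff_dom hψ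
  have hdom' : ∀ y n, jump empty (h (y, n)) = false ↔
      ∃ w, Encodable.decode (α := α) n = some w ∧ ∀ t, D (y, w, t) = true := by
    intro y n
    rw [← Bool.not_eq_true, hdom, rfind_some_dom]
    cases hn : Encodable.decode (α := α) n <;> simp [D', hn]
  let G' : ℕ → ℕ := fun p =>
    (Encodable.decode (α := α) p.unpair.2).casesOn 0 fun w => G (p.unpair.1, w)
  have hG' : Computable G' :=
    Computable.option_casesOn (Computable.decode.comp (Computable.snd.comp Computable.unpair))
      (.const 0) (hG.comp ((Computable.fst.comp (Computable.unpair.comp Computable.fst)).pair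
        Computable.snd)).to₂
  obtain ⟨ch, hch⟩ := OCode.exists_eval_eq_of_computable (hh.comp Computable.unpair)
  obtain ⟨cG, hcG⟩ := OCode.exists_eval_eq_of_computable hG'
  refine ⟨.comp cG (.pair .left (.comp (.rfind (.comp .oracle ch)) .right)), fun y hy => ?_⟩
  have hor : ∀ k b, b ∈ OCode.eval (oracleOf (jump empty)) (.comp .oracle ch) (Nat.pair y k) ↔
      b = (jump empty (h (y, k))).toNat := by
    intro k b
    simp only [OCode.mem_eval_comp, hch, Part.mem_some_iff, exists_eq_left, Nat.unpair_pair]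
    exact Part.mem_some_iff
  have hex : ∃ n, jump empty (h (y, n)) = false := by
    obtain ⟨w, hw⟩ := hy
    exact ⟨Encodable.encode w, (hdom' _ _).2 ⟨w, Encodable.encodek w, hw⟩⟩
  obtain ⟨w, hw, hwD⟩ := (hdom' _ _).1 (Nat.find_spec hex)
  refine ⟨w, hwD, fun j => OCode.mem_eval_comp.2 ⟨Nat.pair j (Nat.find hex),
    OCode.mem_eval_pair.2 ⟨j, ?_, Nat.find hex, OCode.mem_eval_comp.2 ⟨y, ?_,
      OCode.mem_eval_rfind.2 ⟨?_, fun k hk => ⟨_, (hor k _).2 rfl, ?_⟩⟩⟩, rfl⟩, ?_⟩⟩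
  · simp [OCode.eval]
  · simp [OCode.eval]
  · rw [hor, Nat.find_spec hex]
    rfl
  · rw [Bool.eq_true_of_not_eq_false (Nat.find_min hex hk)]
    simp
  · rw [hcG]
    simp [G', hw]

/-! ### The measure of a class determined by initial segments -/

instance : IsProbabilityMeasure coin := by unfold coin; infer_instance

theorem initSeg_eq_initSeg_iff {Z W : Cantor} {n : ℕ} :
    initSeg Z n = initSeg W n ↔ ∀ i < n, Z i = W i := by
  simp [initSeg]

theorem setOf_initSeg_eq (W : Cantor) (n : ℕ) :
    {Z | initSeg Z n = initSeg W n} = Set.pi (Finset.range n : Set ℕ) fun i => {W i} := by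
  ext Z
  simp [initSeg_eq_initSeg_iff, Set.mem_pi]

theorem exists_eq_initSeg (τ : List Bool) : ∃ W : Cantor, τ = initSeg W τ.length := by
  refine ⟨fun i => τ.getD i false, List.ext_getElem (by simp) fun i h _ => ?_⟩
  simp [initSeg, h]

theorem coin_initSeg_eq (W : Cantor) (n : ℕ) :
    coin {Z | initSeg Z n = initSeg W n} = (2⁻¹ : ℝ≥0∞) ^ n := by
  rw [setOf_initSeg_eq, coin, Measure.infinitePi_pi _ fun i _ => measurableSet_singleton _]
  simp [PMF.uniformOfFintype_apply]

theorem measurableSet_initSeg_eq (τ : List Bool) (n : ℕ) :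
    MeasurableSet {Z : Cantor | initSeg Z n = τ} := by
  by_cases h : τ.length = n
  · obtain ⟨W, hW⟩ := exists_eq_initSeg τ
    rw [hW, h, setOf_initSeg_eq]
    exact MeasurableSet.pi (Set.to_countable _) fun i _ => measurableSet_singleton _
  · convert! MeasurableSet.empty
    ext Z
    simp only [Set.mem_ofPred_eq, Set.mem_empty_iff_false, iff_false]
    rintro rfl
    simp at h

theorem setOf_initSeg (p : List Bool → Bool) (n : ℕ) :
    {Z : Cantor | p (initSeg Z n) = true} =
      ⋃ τ ∈ (strings n).toFinset.filter fun σ => p σ = true, {Z | initSeg Z n = τ} := by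
  ext Z
  simp [mem_strings]

theorem measurableSet_initSeg (p : List Bool → Bool) (n : ℕ) :
    MeasurableSet {Z : Cantor | p (initSeg Z n) = true} := by
  rw [setOf_initSeg]
  exact Finset.measurableSet_biUnion _ fun τ _ => measurableSet_initSeg_eq τ n

theorem coin_initSeg (p : List Bool → Bool) (n : ℕ) :
    coin {Z | p (initSeg Z n) = true} = (strings n).countP p * (2⁻¹ : ℝ≥0∞) ^ n := by
  rw [setOf_initSeg, measure_biUnion_finset _ fun τ _ => measurableSet_initSeg_eq τ n,
    countP_strings]
  · rw [Finset.sum_congr rfl fun τ hτ => ?_, Finset.sum_const, nsmul_eq_mul]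
    obtain ⟨W, hW⟩ := exists_eq_initSeg τ
    simp only [Finset.mem_filter, List.mem_toFinset, mem_strings] at hτ
    rw [hW, hτ.1, coin_initSeg_eq]
  · intro τ _ τ' _ hne
    exact Set.disjoint_left.2 fun Z h h' => hne (h.symm.trans h')

/-- Comparing the measure of such a class with `2^{-k}` amounts to counting strings. -/
theorem coin_initSeg_le_iff (p : List Bool → Bool) (n k : ℕ) :
    coin {Z | p (initSeg Z n) = true} ≤ (2⁻¹ : ℝ≥0∞) ^ k ↔
      (strings n).countP p * 2 ^ k ≤ 2 ^ n := by
  have h0 : ∀ m, (2 : ℝ≥0∞) ^ m ≠ 0 := fun m => pow_ne_zero _ two_ne_zero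
  have ht : ∀ m, (2 : ℝ≥0∞) ^ m ≠ ∞ := fun m => ENNReal.pow_ne_top ENNReal.ofNat_ne_top
  rw [coin_initSeg, ← ENNReal.inv_pow, ← ENNReal.inv_pow, ← div_eq_mul_inv,
    ENNReal.div_le_iff (h0 _) (ht _), mul_comm _ ((2 : ℝ≥0∞) ^ n), ← div_eq_mul_inv,
    ENNReal.le_div_iff_mul_le (.inl (h0 _)) (.inl (ht _))]
  exact_mod_cast Iff.rfl

/-! ### Predicting the output of a truth-table reduction -/

/-- Some query in `L` is answered positively by the approximation to the jump along `τ`, but not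
yet by its stage `s`. -/
noncomputable def changesAfter (L : List ℕ) (s : ℕ) (τ : List Bool) : Bool :=
  decide (∃ e ∈ L, jumpApprox τ e = true ∧ jumpApprox (τ.take s) e = false)

theorem changesAfter_initSeg {L : List ℕ} {s n : ℕ} {Z : Cantor} :
    changesAfter L s (initSeg Z n) = true ↔
      ∃ e ∈ L, jumpApprox (initSeg Z n) e = true ∧ jumpApprox (initSeg Z s) e = false := by
  simp only [changesAfter, decide_eq_true_eq, take_initSeg]
  refine exists_congr fun e => and_congr_right fun _ => and_congr_right fun h => ?_
  rcases le_total s n with hsn | hsn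
  · rw [min_eq_left hsn]
  · rw [min_eq_right hsn, h, jumpApprox_mono hsn h]

theorem monotone_changesAfter (L : List ℕ) (s : ℕ) :
    Monotone fun n => {Z : Cantor | changesAfter L s (initSeg Z n) = true} := by
  intro n m hnm Z hZ
  obtain ⟨e, he, h1, h2⟩ := changesAfter_initSeg.1 hZ
  exact changesAfter_initSeg.2 ⟨e, he, jumpApprox_mono hnm h1, h2⟩

/-- Some stage of the approximation to the jump is correct on the finite set `L` of queries, up to
measure `ε`: the sets on which stage `s` is wrong decrease to the empty set. -/
theorem exists_stage (L : List ℕ) {ε : ℝ≥0∞} (hε : 0 < ε) :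
    ∃ s, ∀ n, coin {Z | changesAfter L s (initSeg Z n) = true} ≤ ε := by
  let B : ℕ → Set Cantor := fun s => ⋃ n, {Z | changesAfter L s (initSeg Z n) = true}
  have hB : ∀ s, MeasurableSet (B s) := fun s =>
    MeasurableSet.iUnion fun n => measurableSet_initSeg _ n
  have hanti : Antitone B := by
    intro s s' hs Z hZ
    obtain ⟨n, hn⟩ := Set.mem_iUnion.1 hZ
    obtain ⟨e, he, h1, h2⟩ := changesAfter_initSeg.1 hn
    refine Set.mem_iUnion.2 ⟨n, changesAfter_initSeg.2 ⟨e, he, h1, ?_⟩⟩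
    rw [Bool.eq_false_iff] at h2 ⊢
    exact fun h => h2 (jumpApprox_mono hs h)
  have hempty : ⋂ s, B s = ∅ := by
    refine Set.eq_empty_of_forall_notMem fun Z hZ => ?_
    obtain ⟨s, hs⟩ := (eventually_map_jumpApprox_eq Z L).exists
    obtain ⟨n, hn⟩ := Set.mem_iUnion.1 (Set.mem_iInter.1 hZ s)
    obtain ⟨e, he, h1, h2⟩ := changesAfter_initSeg.1 hn
    rw [List.map_inj_left.1 hs e he, jump_eq_true_iff.2 ⟨n, h1⟩] at h2
    simp at h2
  have hlim := tendsto_measure_iInter_atTop (μ := coin) (fun s => (hB s).nullMeasurableSet)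
    hanti ⟨0, measure_ne_top _ _⟩
  rw [hempty, measure_empty] at hlim
  obtain ⟨s, hs⟩ := (hlim.eventually (eventually_lt_nhds hε)).exists
  exact ⟨s, fun n => (measure_mono (Set.subset_iUnion _ n)).trans hs.le⟩

section reduction
variable (q : ℕ → List ℕ) (t : ℕ × List Bool → Bool)

/-- The negated values, at the inputs `xs`, of the truth-table reduction `(q, t)` applied to the
approximation of the jump given by `τ`. -/
noncomputable def negOutput (xs : List ℕ) (τ : List Bool) : List Bool :=
  xs.map fun x => !t (x, (q x).map (jumpApprox τ))

/-- `w = (s, v)` consists of a stage `s` by which the approximation to the jump has settled on the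
queries made at `xs`, up to measure `2^{-|xs|}` as far as strings of length `n` show; and of a
string `v` which predicts the negated output at stage `s` with probability at most `2^{-|xs|}`. -/
noncomputable def isPrediction (xs : List ℕ) (w : ℕ × List Bool) (n : ℕ) : Bool :=
  decide ((w.2.length = xs.length ∧
    (strings w.1).countP (fun τ => decide (negOutput q t xs τ = w.2)) * 2 ^ xs.length ≤ 2 ^ w.1) ∧
    (strings n).countP (changesAfter (xs.flatMap q) w.1) * 2 ^ xs.length ≤ 2 ^ n)

/-- The string comes from the pigeonhole principle: the `2^s` strings of length `s` have negated
outputs among the `2^{|xs|}` strings of length `|xs|`. -/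
theorem exists_isPrediction (xs : List ℕ) : ∃ w, ∀ n, isPrediction q t xs w n = true := by
  obtain ⟨s, hs⟩ := exists_stage (xs.flatMap q)
    (show 0 < (2⁻¹ : ℝ≥0∞) ^ xs.length from ENNReal.pow_pos (by simp) _)
  have hcard : ∀ n, ((strings n).toFinset.card : ℚ) = 2 ^ n := fun n => by
    rw [List.toFinset_card_of_nodup (nodup_strings n), length_strings]
    simp
  obtain ⟨v, hv, hle⟩ := Finset.exists_card_fiber_le_of_card_le_nsmul
    (s := (strings s).toFinset) (t := (strings xs.length).toFinset) (f := negOutput q t xs)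
    (b := (2 ^ s / 2 ^ xs.length : ℚ)) 
    ⟨List.replicate xs.length false, by simp [mem_strings]⟩
    (by rw [nsmul_eq_mul, hcard, hcard, mul_div_cancel₀]; positivity)
  refine ⟨(s, v), fun n => decide_eq_true ⟨⟨by simpa [mem_strings] using hv, ?_⟩,
    (coin_initSeg_le_iff _ _ _).1 (hs n)⟩⟩
  rw [le_div_iff₀ (by positivity)] at hle
  rw [countP_strings]
  simp only [decide_eq_true_eq]
  exact_mod_cast hle

/-- The reduction, applied to `Z'`, has the predicted negated output only if stage `w.1` is wrong
about one of the queries or the prediction is right at that stage. -/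
theorem coin_negOutput_le {xs : List ℕ} {w : ℕ × List Bool}
    (hw : ∀ n, isPrediction q t xs w n = true) :
    coin {Z | (xs.map fun x => !t (x, (q x).map (jump Z))) = w.2} ≤
      2 * (2⁻¹ : ℝ≥0∞) ^ xs.length := by
  simp only [isPrediction, decide_eq_true_eq] at hw
  have h1 : coin (⋃ n, {Z | changesAfter (xs.flatMap q) w.1 (initSeg Z n) = true}) ≤
      (2⁻¹ : ℝ≥0∞) ^ xs.length := by
    rw [(monotone_changesAfter _ _).measure_iUnion]
    exact iSup_le fun n => (coin_initSeg_le_iff _ _ _).2 (hw n).2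
  have h2 := (coin_initSeg_le_iff _ _ _).2 (hw 0).1.2
  rw [two_mul]
  refine (measure_mono fun Z hZ => ?_).trans ((measure_union_le _ _).trans (add_le_add h1 h2))
  by_cases hc : ∀ e ∈ xs.flatMap q, jumpApprox (initSeg Z w.1) e = jump Z e
  · right
    have : negOutput q t xs (initSeg Z w.1) = w.2 := by
      rw [← hZ.out]
      refine List.map_congr_left fun x hx => ?_
      rw [List.map_congr_left fun e he => hc e (List.mem_flatMap.2 ⟨x, hx, he⟩)]
    simpa using this
  · left
    push Not at hc
    obtain ⟨e, he, hne⟩ := hc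
    have hj : jump Z e = true := by
      by_contra h
      refine hne ?_
      rw [Bool.eq_false_iff.2 h, Bool.eq_false_iff]
      exact fun h' => h (jump_eq_true_iff.2 ⟨_, h'⟩)
    obtain ⟨n, hn⟩ := jump_eq_true_iff.1 hj
    rw [hj] at hne
    exact Set.mem_iUnion.2 ⟨n, changesAfter_initSeg.2 ⟨e, he, hn, Bool.eq_false_iff.2 hne⟩⟩

end reduction

/-! ### Diagonalization against almost all sets -/

/-- The inputs at which a program `p` with oracle `∅'` will defeat a d.n.c. function. For
`y = (k, p)` there are `k` of them: the `j`-th is the number of a program that, on any argument,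
runs the program `p` on `(j, y)`. Since `p` occurs in `y`, the program `p` can compute the list,
and no appeal to the recursion theorem is needed. -/
def diagInputs (y : ℕ) : List ℕ :=
  (List.range y.unpair.1).map fun j =>
    4 * Nat.pair y.unpair.2 (OCode.const (Nat.pair j y)).toNat + 1 + 5

theorem primrec_diagInputs : Primrec diagInputs :=
  Primrec.list_map (Primrec.list_range.comp (Primrec.fst.comp Primrec.unpair))
    (OCode.primrec₂_comp_number.comp (Primrec.snd.comp (Primrec.unpair.comp Primrec.fst))
      (OCode.primrec_toNat_const.comp (Primrec₂.natPair.comp Primrec.snd Primrec.fst))).to₂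

theorem primrec_changesAfter {γ : Type*} [Primcodable γ] {L : γ → List ℕ} {s : γ → ℕ}
    {τ : γ → List Bool} (hL : Primrec L) (hs : Primrec s) (hτ : Primrec τ) :
    Primrec fun a => changesAfter (L a) (s a) (τ a) := by
  have hR : PrimrecRel fun (e : ℕ) (a : ℕ × List Bool) =>
      jumpApprox a.2 e = true ∧ jumpApprox (a.2.take a.1) e = false := by
    have hτ : Primrec fun a : ℕ × ℕ × List Bool => a.2.2 := Primrec.snd.comp Primrec.snd
    exact (Primrec.eq.comp (primrec_jumpApprox.comp hτ Primrec.fst) (.const true)).and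
      (Primrec.eq.comp (primrec_jumpApprox.comp (Primrec.list_take.comp
        (Primrec.fst.comp Primrec.snd) hτ) Primrec.fst) (.const false))
  have h : PrimrecPred fun a : (List ℕ × ℕ) × List Bool => ∃ e ∈ a.1.1,
      jumpApprox a.2 e = true ∧ jumpApprox (a.2.take a.1.2) e = false :=
    PrimrecRel.comp hR.exists_mem_list (Primrec.fst.comp Primrec.fst)
      ((Primrec.snd.comp Primrec.fst).pair Primrec.snd)
  exact h.decide.comp ((hL.pair hs).pair hτ)

theorem primrec₂_pow : Primrec₂ fun m n : ℕ => m ^ n := by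
  refine (Primrec.nat_rec (f := fun _ : ℕ => 1) (g := fun (m : ℕ) (p : ℕ × ℕ) => p.2 * m)
    (.const 1) (Primrec.nat_mul.comp (Primrec.snd.comp Primrec.snd) Primrec.fst).to₂).of_eq
    fun m n => ?_
  induction n with
  | zero => rfl
  | succ n ih => simp only [ih, pow_succ]

section reduction
variable {q : ℕ → List ℕ} {t : ℕ × List Bool → Bool}

theorem computable₂_negOutput (hq : Computable q) (ht : Computable t) :
    Computable₂ (negOutput q t) := by
  refine computable_list_map (β := ℕ) Computable.fst ?_
  have h1 : Computable fun a : (List ℕ × List Bool) × ℕ => (q a.2).map (jumpApprox a.1.2) :=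
    computable_list_map (hq.comp Computable.snd) (primrec_jumpApprox.to_comp.comp
      (Computable.snd.comp (Computable.fst.comp Computable.fst)) Computable.snd).to₂
  exact Primrec.not.to_comp.comp (ht.comp (Computable.snd.pair h1))

theorem computable_isPrediction (hq : Computable q) (ht : Computable t) {γ : Type*}
    [Primcodable γ] {xs : γ → List ℕ} {s n : γ → ℕ} {v : γ → List Bool} (hxs : Computable xs)
    (hs : Computable s) (hv : Computable v) (hn : Computable n) :
    Computable fun a => isPrediction q t (xs a) (s a, v a) (n a) := by
  have hpow : ∀ {f : γ → ℕ}, Computable f → Computable fun a => 2 ^ f a :=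
    fun hf => primrec₂_pow.to_comp.comp (.const 2) hf
  have hL : Computable fun a => (xs a).length := Computable.list_length.comp hxs
  have hQ : Computable fun a => (xs a).flatMap q :=
    (Primrec.list_flatten.to_comp.comp (computable_list_map (g := fun _ x => q x) hxs
      (hq.comp Computable.snd))).of_eq fun a => by rw [List.flatMap_def]
  have hc1 : Computable fun a =>
      (strings (s a)).countP fun τ => decide (negOutput q t (xs a) τ = v a) := by
    refine computable_list_countP (primrec_strings.to_comp.comp hs) ?_
    exact (Primrec.eq (α := List Bool)).decide.to_comp.comp ((computable₂_negOutput hq ht).comp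
      (hxs.comp Computable.fst) Computable.snd) (hv.comp Computable.fst)
  have hca : Computable fun b : (List ℕ × ℕ) × List Bool => changesAfter b.1.1 b.1.2 b.2 :=
    (primrec_changesAfter (Primrec.fst.comp Primrec.fst) (Primrec.snd.comp Primrec.fst)
      Primrec.snd).to_comp
  have hc2 : Computable fun a =>
      (strings (n a)).countP (changesAfter ((xs a).flatMap q) (s a)) := by
    refine computable_list_countP (primrec_strings.to_comp.comp hn) ?_
    have h : Computable fun b : γ × List Bool => (((xs b.1).flatMap q, s b.1), b.2) :=
      ((hQ.comp Computable.fst).pair (hs.comp Computable.fst)).pair Computable.snd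
    exact hca.comp h
  have hle : Computable₂ fun m n : ℕ => decide (m ≤ n) := Primrec.nat_le.decide.to_comp
  have heq : Computable₂ fun m n : ℕ => decide (m = n) := (Primrec.eq (α := ℕ)).decide.to_comp
  have hmul : Computable₂ fun m n : ℕ => m * n := Primrec.nat_mul.to_comp
  have hand : Computable₂ and := Primrec.and.to_comp
  have h1 := heq.comp (Computable.list_length.comp hv) hL
  have h2 := hle.comp (hmul.comp hc1 (hpow hL)) (hpow hs)
  have h3 := hle.comp (hmul.comp hc2 (hpow hL)) (hpow hn)
  refine (hand.comp (hand.comp h1 h2) h3).of_eq fun a => ?_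
  simp only [isPrediction, Bool.decide_and]

/-- For almost no `Z` does a given truth-table reduction to `Z'` yield a d.n.c. function relative to
`∅'`: a `{0,1}`-valued d.n.c. function takes the negation of every bit output by `J^{∅'}`. -/
theorem coin_setOf_dncRel_eq_zero (hq : Computable q) (ht : Computable t) :
    coin {Z | DNCRel (jump empty) fun x => (t (x, (q x).map (jump Z))).toNat} = 0 := by
  have hD : Computable fun a : ℕ × (ℕ × List Bool) × ℕ =>
      isPrediction q t (diagInputs a.1) (a.2.1.1, a.2.1.2) a.2.2 :=
    computable_isPrediction hq ht (primrec_diagInputs.to_comp.comp Computable.fst)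
      (Computable.fst.comp (Computable.fst.comp Computable.snd))
      (Computable.snd.comp (Computable.fst.comp Computable.snd))
      (Computable.snd.comp Computable.snd)
  have hG : Computable fun a : ℕ × ℕ × List Bool => (a.2.2.getD a.1 false).toNat :=
    ((Primrec.dom_finite Bool.toNat).comp ((Primrec.list_getD false).comp
      (Primrec.snd.comp Primrec.snd) Primrec.fst)).to_comp
  obtain ⟨c, hc⟩ := exists_code_search hD hG
  have hbound : ∀ k : ℕ, coin {Z | DNCRel (jump empty) fun x =>
      (t (x, (q x).map (jump Z))).toNat} ≤ 2 * (2⁻¹ : ℝ≥0∞) ^ k := by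
    intro k
    obtain ⟨w, hw, hcw⟩ := hc (Nat.pair k c.toNat) 
      (exists_isPrediction q t (diagInputs (Nat.pair k c.toNat)))
    replace hw : ∀ n, isPrediction q t (diagInputs (Nat.pair k c.toNat)) w n = true := hw
    have hlen : (diagInputs (Nat.pair k c.toNat)).length = k := by simp [diagInputs]
    have hwlen : w.2.length = k := by
      have := hw 0
      simp only [isPrediction, decide_eq_true_eq] at this
      rw [this.1.1, hlen]
    have hle := coin_negOutput_le q t hw
    rw [hlen] at hle
    refine (measure_mono fun Z hZ => ?_).trans hle
    refine List.ext_getElem (by rw [List.length_map, hlen, hwlen]) fun j hj hj' => ?_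
    -- The `j`-th input is the number of a program with constant value `w.2[j]`.
    have hval : (w.2[j]).toNat ∈ J (jump empty) ((diagInputs (Nat.pair k c.toNat))[j]'(by
        simpa using hj)) := by
      simp only [diagInputs, List.getElem_map, List.getElem_range, Nat.unpair_pair]
      rw [J, Phi, OCode.ofNat_comp_number, OCode.ofNat_toNat, OCode.ofNat_toNat, OCode.mem_eval_comp]
      refine ⟨Nat.pair j (Nat.pair k c.toNat), ?_, ?_⟩
      · rw [OCode.eval_const]
        exact Part.mem_some _
      · rw [← List.getD_eq_getElem w.2 false hj']
        exact hcw j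
    rw [List.getElem_map]
    have hne := hZ.out ((diagInputs (Nat.pair k c.toNat))[j]'(by simpa using hj))
    generalize (diagInputs (Nat.pair k c.toNat))[j]'(by simpa using hj) = x at hval hne ⊢
    refine (Bool.eq_not_of_ne fun h => hne ?_).symm
    simpa only [← h] using hval
  have hlim : Tendsto (fun k : ℕ => 2 * (2⁻¹ : ℝ≥0∞) ^ k) atTop (nhds (2 * 0)) :=
    ENNReal.Tendsto.const_mul (ENNReal.tendsto_pow_atTop_nhds_zero_of_lt_one
      (ENNReal.inv_lt_one.2 ENNReal.one_lt_two)) (.inr ENNReal.ofNat_ne_top)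
  rw [mul_zero] at hlim
  exact le_antisymm (ge_of_tendsto' hlim hbound) zero_le

end reduction

theorem countable_computable (α β : Type*) [Primcodable α] [Primcodable β] :
    Countable {f : α → β // Computable f} := by
  choose c hc using fun f : {f : α → β // Computable f} => computable_iff_exists_runStep.1 f.2
  refine Function.Injective.countable (f := c) fun f g hfg => Subtype.ext (funext fun a => ?_)
  obtain ⟨s, hs⟩ := hc f a
  obtain ⟨s', hs'⟩ := hc g a
  rw [hfg] at hs
  exact runStep_unique hs hs'

theorem coin_dncClass : coin dncClass = 0 := by
  have := countable_computable ℕ (List ℕ)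
  have := countable_computable (ℕ × List Bool) Bool
  refine measure_mono_null (t := ⋃ (q : {q : ℕ → List ℕ // Computable q})
    (t : {t : ℕ × List Bool → Bool // Computable t}),
    {Z | DNCRel (jump empty) fun x => (t.1 (x, (q.1 x).map (jump Z))).toNat}) ?_
    (measure_iUnion_null fun q => measure_iUnion_null fun t => coin_setOf_dncRel_eq_zero q.2 t.2)
  rintro Z ⟨f, ⟨q, t, hq, ht, hf⟩, hdnc⟩
  refine Set.mem_iUnion₂.2 ⟨⟨q, hq⟩, ⟨fun a => t a.1 a.2, ht⟩, ?_⟩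
  change DNCRel _ _
  simpa only [hf] using hdnc

end Superhigh

theorem theorem3p2 :
    Superhigh.Shigh ⊆ Superhigh.dncClass ∧
      Superhigh.IsSigma03 Superhigh.dncClass ∧
      Superhigh.coin Superhigh.dncClass = 0 :=
  ⟨Superhigh.Shigh_subset_dncClass, Superhigh.isSigma03_dncClass, Superhigh.coin_dncClass⟩
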